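/- Let $\mathcal H$ be a separable complex Hilbert space, and let $\mathcal W,\mathcal M\subseteq\mathcal H$ be closed subspaces such that $\mathcal H=\mathcal W\dot+\mathcal M^\perp$ (a direct sum, not necessarily orthogonal). Let $\mathcal F=\{f_n\}_{n\in N}$ be a frame for $\mathcal W$ and $\mathcal G=\{g_k\}_{k\in K}$ a frame for $\mathcal M$, where the index sets $N,K$ are countable (finite or infinite); that is, $f_n\in\mathcal W$ and there are $a,b>0$ with $a\|x\|^2\le\sum_n|\langle x,f_n\rangle|^2\le b\|x\|^2$ for all $x\in\mathcal W$, and similarly for $\mathcal G$ and $\mathcal M$. Let $T:\ell^2(N)\to\mathcal H$, $Te_n=f_n$, and $B:\ell^2(K)\to\mathcal H$, $Be_k=g_k$, be their synthesis operators. Let $\mathcal D(\ell^2)$ be the set of all bounded positive invertible operators on $\ell^2(N)$ that are diagonal in the canonical basis, and let $A^\dagger$ denote the Moore-Penrose pseudoinverse of a bounded operator $A$ with closed range. Call $\mathcal F$ a Riesz frame for $\mathcal W$ if there are $a,b>0$ such that for every $I\subseteq N$ the subfamily $\{f_n\}_{n\in I}$ is a frame for $\overline{\operatorname{span}}\{f_n:n\in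 I\}$ with (not necessarily optimal) bounds $a,b$. Then, for every $D\in\mathcal D(\ell^2)$, the operator $D^{-1/2}T^*B$ has closed range, and the following conditions are equivalent: 1. $\mathcal F$ is a Riesz frame for $\mathcal W$. 2. $\displaystyle\sup_{D\in\mathcal D(\ell^2)}\bigl\|B\,(D^{-1/2}T^*B)^\dagger D^{-1/2}\bigr\|<\infty .$ -/

import Mathlib

open ContinuousLinearMap

section Frames

variable {ι : Type*} {H : Type*} [NormedAddCommGroup H] [InnerProductSpace ℂ H]

/-- `f` is a frame for the subspace `W`, with (not necessarily optimal) frame bounds `A, B > 0`: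
the vectors lie in `W`, and `A ‖x‖² ≤ ∑ |⟨x, f n⟩|² ≤ B ‖x‖²` for every `x ∈ W`, the series being
convergent. -/
structure IsFrameWithBounds (f : ι → H) (W : Submodule ℂ H) (A B : ℝ) : Prop where
  mem : ∀ n, f n ∈ W
  lower_pos : 0 < A
  upper_pos : 0 < B
  summable : ∀ x ∈ W, Summable fun n => ‖inner ℂ (f n) x‖ ^ 2
  lower : ∀ x ∈ W, A * ‖x‖ ^ 2 ≤ ∑' n, ‖inner ℂ (f n) x‖ ^ 2
  upper : ∀ x ∈ W, ∑' n, ‖inner ℂ (f n) x‖ ^ 2 ≤ B * ‖x‖ ^ 2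

/-- `f` is a frame for the subspace `W`. -/
def IsFrame (f : ι → H) (W : Submodule ℂ H) : Prop :=
  ∃ A B : ℝ, IsFrameWithBounds f W A B

/-- `f` is a Riesz frame for `W`: a frame for `W` such that all subfamilies `(f n)_{n ∈ I}` are
frames for their closed linear spans, with common frame bounds. -/
def IsRieszFrame (f : ι → H) (W : Submodule ℂ H) : Prop :=
  IsFrame f W ∧ ∃ A B : ℝ, ∀ I : Set ι,
    IsFrameWithBounds (fun n : I => f n) (Submodule.span ℂ (f '' I)).topologicalClosure A B

/-- The analysis operator `x ↦ (⟨x, f n⟩)_n` of a frame for `W`, on `W`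
(Mathlib's inner product is linear in its second argument). -/
noncomputable def IsFrame.analysis {f : ι → H} {W : Submodule ℂ H} (hf : IsFrame f W) :
    W →L[ℂ] lp (fun _ : ι => ℂ) 2 :=
  LinearMap.mkContinuousOfExistsBound
    { toFun := fun x => ⟨fun n => inner ℂ (f n) (x : H), by
        obtain ⟨A, B, h⟩ := hf
        refine memℓp_gen ?_
        simpa using h.summable x x.2⟩
      map_add' := fun x y => by
        exact lp.ext (funext fun n => inner_add_right _ _ _)
      map_smul' := fun c x => by
        exact lp.ext (funext fun n => inner_smul_right _ _ _) }
    (by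
      obtain ⟨A, B, h⟩ := hf
      refine ⟨Real.sqrt B, fun x => ?_⟩
      refine le_of_sq_le_sq ?_ (by positivity)
      rw [mul_pow, Real.sq_sqrt h.upper_pos.le]
      have h2 := h.upper x x.2
      have h3 := lp.norm_rpow_eq_tsum (p := 2) (E := fun _ : ι => ℂ) (by norm_num)
        (⟨fun n => inner ℂ (f n) (x : H), by
          refine memℓp_gen ?_
          simpa using h.summable x x.2⟩ : lp (fun _ : ι => ℂ) 2)
      simp only [ENNReal.toReal_ofNat, Real.rpow_ofNat] at h3
      simpa [h3] using h2)

/-- The synthesis operator `T : ℓ² → H` of a frame `f` for the closed subspace `W`, i.e. the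
bounded operator with `T e_n = f n` (see `IsFrame.synthesis_single`), obtained as the adjoint of
the analysis operator followed by the inclusion of `W` in `H`. -/
noncomputable def IsFrame.synthesis {f : ι → H} {W : Submodule ℂ H} [CompleteSpace W]
    (hf : IsFrame f W) : lp (fun _ : ι => ℂ) 2 →L[ℂ] H :=
  W.subtypeL ∘L adjoint hf.analysis

theorem IsFrame.synthesis_single [DecidableEq ι] {f : ι → H} {W : Submodule ℂ H} [CompleteSpace W]
    (hf : IsFrame f W) (n : ι) : hf.synthesis (lp.single 2 n (1 : ℂ)) = f n := by
  obtain ⟨A, B, h⟩ := id hf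
  have key : adjoint hf.analysis (lp.single 2 n (1 : ℂ)) = (⟨f n, h.mem n⟩ : W) := by
    refine ext_inner_right ℂ fun x => ?_
    rw [adjoint_inner_left, lp.inner_single_left]
    simp [IsFrame.analysis]
  simp [IsFrame.synthesis, key]

end Frames

section PseudoInverse

variable {E F : Type*} [NormedAddCommGroup E] [InnerProductSpace ℂ E] [CompleteSpace E]
  [NormedAddCommGroup F] [InnerProductSpace ℂ F] [CompleteSpace F]

/-- The four Penrose equations: `X` is the Moore-Penrose generalized inverse of `A`. -/
structure IsMoorePenroseInverse (A : E →L[ℂ] F) (X : F →L[ℂ] E) : Prop where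
  comp_comp_left : A ∘L X ∘L A = A
  comp_comp_right : X ∘L A ∘L X = X
  isSelfAdjoint_left : IsSelfAdjoint (A ∘L X)
  isSelfAdjoint_right : IsSelfAdjoint (X ∘L A)

theorem exists_isMoorePenroseInverse (A : E →L[ℂ] F) (hA : IsClosed (Set.range A)) :
    ∃ X : F →L[ℂ] E, IsMoorePenroseInverse A X := by
  set K : Submodule ℂ E := A.ker with hK
  set R : Submodule ℂ F := A.range with hR
  have hRc : IsClosed (R : Set F) := hA
  have : CompleteSpace R := hRc.completeSpace_coe
  have hKc : IsClosed (K : Set E) := A.isClosed_ker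
  have : CompleteSpace K := hKc.completeSpace_coe
  let A' : Kᗮ →L[ℂ] R := (A ∘L Kᗮ.subtypeL).codRestrict R (fun x => ⟨x, rfl⟩)
  have hproj : ∀ x : E, A (Kᗮ.starProjection x) = A x := by
    intro x
    have h1 : K.starProjection x ∈ K := K.starProjection_apply_mem x
    have h2 : A (K.starProjection x) = 0 := h1
    have h3 := K.starProjection_add_starProjection_orthogonal x
    conv_rhs => rw [← h3]
    rw [map_add, h2, zero_add]
  have hinj : A'.ker = ⊥ := by
    rw [LinearMap.ker_eq_bot']
    intro x hx
    have h1 : A (x : E) = 0 := congrArg Subtype.val hx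
    have h2 : (x : E) ∈ K := h1
    have h3 : inner ℂ (x : E) (x : E) = 0 := (Submodule.mem_orthogonal K _).1 x.2 _ h2
    exact Subtype.ext (inner_self_eq_zero.1 h3)
  have hsurj : A'.range = ⊤ := by
    rw [LinearMap.range_eq_top]
    rintro ⟨y, x, rfl⟩
    refine ⟨⟨Kᗮ.starProjection x, Submodule.starProjection_apply_mem _ _⟩, Subtype.ext ?_⟩
    exact hproj x
  let e := ContinuousLinearEquiv.ofBijective A' hinj hsurj
  let X : F →L[ℂ] E := Kᗮ.subtypeL ∘L (e.symm : R →L[ℂ] Kᗮ) ∘L R.orthogonalProjectionOnto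
  have hAe : ∀ z : Kᗮ, A (z : E) = (e z : F) := fun z => rfl
  have hAX : A ∘L X = R.starProjection := by
    ext y
    change A ((e.symm (R.orthogonalProjectionOnto y) : Kᗮ) : E) = _
    rw [hAe, ContinuousLinearEquiv.apply_symm_apply]
    rfl
  have hXA : X ∘L A = Kᗮ.starProjection := by
    ext x
    change ((e.symm (R.orthogonalProjectionOnto (A x)) : Kᗮ) : E) = _
    have h1 : R.orthogonalProjectionOnto (A x) = e (Kᗮ.orthogonalProjectionOnto x) := by
      have h2 : R.orthogonalProjectionOnto (A x) = (⟨A x, x, rfl⟩ : R) :=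
        Submodule.orthogonalProjectionOnto_mem_subspace_eq_self (⟨A x, x, rfl⟩ : R)
      rw [h2]
      exact Subtype.ext (hproj x).symm
    rw [h1, ContinuousLinearEquiv.symm_apply_apply]
    rfl
  refine ⟨X, ?_, ?_, ?_, ?_⟩
  · rw [hXA]
    ext x
    exact hproj x
  · rw [hAX]
    ext y
    change ((e.symm (R.orthogonalProjectionOnto (R.starProjection y)) : Kᗮ) : E) =
      ((e.symm (R.orthogonalProjectionOnto y) : Kᗮ) : E)
    rw [Submodule.starProjection_apply, Submodule.orthogonalProjectionOnto_mem_subspace_eq_self]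
  · rw [hAX]
    exact isSelfAdjoint_starProjection R
  · rw [hXA]
    exact isSelfAdjoint_starProjection Kᗮ

open Classical in
/-- The Moore-Penrose pseudoinverse of a bounded operator with closed range
(with the value `0` if the range is not closed). -/
noncomputable def pinv (A : E →L[ℂ] F) : F →L[ℂ] E :=
  if hA : IsClosed (Set.range A) then (exists_isMoorePenroseInverse A hA).choose else 0

theorem isMoorePenroseInverse_pinv (A : E →L[ℂ] F) (hA : IsClosed (Set.range A)) :
    IsMoorePenroseInverse A (pinv A) := by
  rw [pinv, dif_pos hA]
  exact (exists_isMoorePenroseInverse A hA).choose_spec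

theorem IsMoorePenroseInverse.eq {A : E →L[ℂ] F} {X Y : F →L[ℂ] E}
    (hX : IsMoorePenroseInverse A X) (hY : IsMoorePenroseInverse A Y) : X = Y := by
  have e1 : A ∘L X = A ∘L Y := by
    have h := congrArg adjoint (show (A ∘L X) ∘L (A ∘L Y) = A ∘L Y by
      rw [← comp_assoc, comp_assoc A X A, hX.comp_comp_left])
    rw [adjoint_comp] at h
    rw [show adjoint (A ∘L X) = A ∘L X from hX.isSelfAdjoint_left,
      show adjoint (A ∘L Y) = A ∘L Y from hY.isSelfAdjoint_left] at h
    rw [← h, ← comp_assoc, comp_assoc A Y A, hY.comp_comp_left]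
  have e2 : X ∘L A = Y ∘L A := by
    have h := congrArg adjoint (show (X ∘L A) ∘L (Y ∘L A) = X ∘L A by
      rw [comp_assoc, hY.comp_comp_left])
    rw [adjoint_comp] at h
    rw [show adjoint (X ∘L A) = X ∘L A from hX.isSelfAdjoint_right,
      show adjoint (Y ∘L A) = Y ∘L A from hY.isSelfAdjoint_right] at h
    rw [← h, comp_assoc, hX.comp_comp_left]
  rw [← hX.comp_comp_right, e1, ← comp_assoc, e2, comp_assoc, hY.comp_comp_right]

end PseudoInverse

/-- `D^{-1/2}` for a positive invertible operator `D` on a Hilbert space, in the sense of the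
continuous functional calculus. -/
noncomputable def invSqrt {E : Type*} [NormedAddCommGroup E] [InnerProductSpace ℂ E]
    [CompleteSpace E] (D : E →L[ℂ] E) : E →L[ℂ] E :=
  D ^ (-(1 / 2) : ℝ)

/-- The set `𝒟(ℓ²)` of all positive invertible operators on `ℓ²(ι)` that are diagonal with
respect to the canonical basis. -/
def diagonalWeights (ι : Type*) :
    Set (lp (fun _ : ι => ℂ) 2 →L[ℂ] lp (fun _ : ι => ℂ) 2) :=
  {D | D.IsPositive ∧ IsUnit D ∧ ∃ d : ι → ℂ, ∀ x n, D x n = d n * x n}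

/-! ### Finite weighted least squares with bounds independent of the weights. -/

section FiniteLeastSquares

variable {ι H : Type*} [NormedAddCommGroup H] [InnerProductSpace ℂ H]

/-! The vector $z=B(D^{-1/2}T^*B)^\dagger D^{-1/2}y$ lies in $\mathcal M$ and solves the normal
equations $TD^{-1}T^*z=TD^{-1}y$ (`IsFrame.inner_residual_eq_zero`), since $\mathcal H=\mathcal
M+\mathcal W^\perp$ gives $T^*B$ the same range as $T^*$. The supremum thus measures how far
weighted least squares solutions can grow with the weight.

Riesz frame implies bounded: a finite weighted problem has a solution that is a convex combination
of solutions of exact subsystems $\langle f_n,z\rangle=y_n$, $n\in I$, with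
$z\in\operatorname{span}\{f_n\}_{n\in I}$. The common lower frame bound controls all of these, so
the weights drop out. A weak form of the estimate survives the limit to infinite families and bounds
$z$ against $\mathcal W$; the oblique projection turns this into a bound on $\|z\|$, as
$z\in\mathcal M$.

Bounded implies Riesz frame: give weight $1$ to the coordinates in $I$ and $\varepsilon$ to the
others, with data $P_IT^*x$, where $P_I$ is the coordinate projection. As $\varepsilon\to0$ the
solutions stay bounded by $C\|P_IT^*x\|$ and match $x$ on $I$, which forces $\|x\|\le C\|P_IT^*x\|$
for $x$ in the closed span of $\{f_n\}_{n\in I}$. -/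

/-- A weighted least squares problem `⟨f n, z⟩ ≈ y n`, `n ∈ J`, has a solution in every convex set
containing the basic solutions, i.e. the vectors `z ∈ span {f n | n ∈ I}`, `I ⊆ J`, which solve
the equations with index in `I` exactly. -/
theorem exists_mem_convex_sum_residual_smul_eq_zero (w : ι → ℝ) (hw : ∀ n, 0 < w n)
    (J : Finset ι) : ∀ (f : ι → H) (y : ι → ℂ) (C : Set H), Convex ℝ C →
      (∀ I ⊆ J, ∀ z ∈ Submodule.span ℂ (f '' I), (∀ n ∈ I, inner ℂ (f n) z = y n) → z ∈ C) →
      ∃ z ∈ C, ∑ n ∈ J, ((w n : ℂ) * (y n - inner ℂ (f n) z)) • f n = 0 := by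
  classical
  induction J using Finset.induction_on with
  | empty =>
    intro f y C _ h
    exact ⟨0, h ∅ subset_rfl 0 (zero_mem _) (by simp), by simp⟩
  | insert n J hn ih =>
    intro f y C hC h
    obtain ⟨z₀, hz₀, e₀⟩ := ih f y C hC
      (fun I hI z hz hIz => h I (hI.trans (Finset.subset_insert _ _)) z hz hIz)
    by_cases hρ : y n - inner ℂ (f n) z₀ = 0
    · exact ⟨z₀, hz₀, by rw [Finset.sum_insert hn, hρ, e₀]; simp⟩
    by_cases hfn : f n = 0
    · exact ⟨z₀, hz₀, by rw [Finset.sum_insert hn, e₀, hfn]; simp⟩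
    have hnn : inner ℂ (f n) (f n) ≠ 0 := inner_self_ne_zero.2 hfn
    -- Impose equation `n` exactly: project the other vectors off `f n` and look for solutions `p +
    -- z` with `z ⊥ f n`. A basic solution of the projected problem, shifted by `p`, is basic for
    -- `insert n I`.
    set a : ι → ℂ := fun m => inner ℂ (f n) (f m) / inner ℂ (f n) (f n) with ha
    set f' : ι → H := fun m => f m - a m • f n with hf'
    have horth : ∀ m, inner ℂ (f n) (f' m) = 0 := by
      intro m
      simp only [hf', ha, inner_sub_right, inner_smul_right]
      field_simp
      ring
    set p : H := (y n / inner ℂ (f n) (f n)) • f n with hp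
    have hnp : inner ℂ (f n) p = y n := by
      rw [hp, inner_smul_right]
      field_simp
    have hinner : ∀ m z, inner ℂ (f n) z = 0 → inner ℂ (f' m) z = inner ℂ (f m) z := by
      intro m z hz
      simp [hf', hz]
    obtain ⟨z', ⟨hz'n, hz'C⟩, e'⟩ := ih f' (fun m => y m - inner ℂ (f m) p)
      {z | inner ℂ (f n) z = 0 ∧ p + z ∈ C} (by
        intro u hu v hv s t hs ht hst
        refine ⟨?_, ?_⟩
        · rw [← Complex.coe_smul, ← Complex.coe_smul, inner_add_right, inner_smul_right,
            inner_smul_right, hu.1, hv.1]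
          simp
        · have h1 := hC hu.2 hv.2 hs ht hst
          have h2 : p + (s • u + t • v) = s • (p + u) + t • (p + v) := by
            have : p = s • p + t • p := by rw [← add_smul, hst, one_smul]
            rw [smul_add, smul_add]
            nth_rw 1 [this]
            abel
          rw [h2]
          exact h1)
      (by
        intro I hI z hz hIz
        have hz0 : inner ℂ (f n) z = 0 := by
          have : Submodule.span ℂ (f' '' I) ≤ (innerSL ℂ (f n)).ker := by
            rw [Submodule.span_le]
            rintro _ ⟨m, -, rfl⟩
            exact horth m
          exact this hz
        refine ⟨hz0, h (insert n I) (Finset.insert_subset_insert _ hI) _ ?_ ?_⟩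
        · have hnI : f n ∈ Submodule.span ℂ (f '' (insert n I : Finset ι)) :=
            Submodule.subset_span ⟨n, by simp, rfl⟩
          refine add_mem (Submodule.smul_mem _ _ hnI) ?_
          have : Submodule.span ℂ (f' '' I) ≤
              Submodule.span ℂ (f '' (insert n I : Finset ι)) := by
            rw [Submodule.span_le]
            rintro _ ⟨m, hm, rfl⟩
            refine sub_mem (Submodule.subset_span ⟨m, ?_, rfl⟩) (Submodule.smul_mem _ _ hnI)
            simpa using Or.inr hm
          exact this hz
        · intro m hm
          rcases Finset.mem_insert.1 hm with rfl | hm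
          · rw [inner_add_right, hnp, hz0, add_zero]
          · rw [inner_add_right, ← hinner m z hz0, hIz m hm]
            ring)
    set z₁ := p + z' with hz₁
    have hn₁ : inner ℂ (f n) z₁ = y n := by rw [hz₁, inner_add_right, hnp, hz'n, add_zero]
    obtain ⟨c, e₁⟩ : ∃ c : ℂ, ∑ m ∈ J, ((w m : ℂ) * (y m - inner ℂ (f m) z₁)) • f m
        = c • f n := by
      refine ⟨∑ m ∈ J, ((w m : ℂ) * (y m - inner ℂ (f m) z₁)) * a m, ?_⟩
      rw [Finset.sum_smul, ← sub_eq_zero, ← Finset.sum_sub_distrib, ← e']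
      refine Finset.sum_congr rfl fun m _ => ?_
      rw [hinner m z' hz'n, hz₁, inner_add_right, hf', smul_sub, smul_smul, sub_sub]
    set ρ : ℂ := y n - inner ℂ (f n) z₀ with hρdef
    have hδ : inner ℂ (f n) (z₁ - z₀) = ρ := by rw [inner_sub_right, hn₁]
    -- The sums over `J` are `0` at `z₀` and `c • f n` at `z₁`. Pairing their difference with `z₁ -
    -- z₀` fixes the phase of `c` relative to `ρ`.
    obtain ⟨t, ht, hct⟩ : ∃ t : ℝ, 0 ≤ t ∧ c * (starRingEnd ℂ) ρ = -(t : ℂ) := by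
      refine ⟨∑ m ∈ J, w m * ‖inner ℂ (f m) (z₁ - z₀)‖ ^ 2,
        Finset.sum_nonneg fun m _ => mul_nonneg (hw m).le (sq_nonneg _), ?_⟩
      have h1 : c • f n = -∑ m ∈ J, ((w m : ℂ) * inner ℂ (f m) (z₁ - z₀)) • f m := by
        rw [← e₁, ← sub_zero (∑ m ∈ J, _), ← e₀, ← Finset.sum_sub_distrib,
          ← Finset.sum_neg_distrib]
        refine Finset.sum_congr rfl fun m _ => ?_
        rw [← sub_smul, ← neg_smul, inner_sub_right]
        congr 1
        ring
      have h2 := congrArg (fun v => inner ℂ (z₁ - z₀) v) h1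
      simp only [inner_smul_right, inner_neg_right, inner_sum] at h2
      rw [← inner_conj_symm, hδ] at h2
      rw [h2]
      push_cast
      congr 1
      refine Finset.sum_congr rfl fun m _ => ?_
      rw [← inner_conj_symm (z₁ - z₀) (f m), mul_assoc, Complex.mul_conj']
    have hρ2 : 0 < ‖ρ‖ ^ 2 := by positivity
    have hwn := hw n
    have hden : 0 < w n * ‖ρ‖ ^ 2 + t := by positivity
    -- At `(1 - θ) • z₀ + θ • z₁` the full sum is `(w n * (1 - θ) * ρ + θ * c) • f n`, and `c = -t *
    -- ρ / ‖ρ‖ ^ 2`; this `θ` is the root.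
    set θ : ℝ := w n * ‖ρ‖ ^ 2 / (w n * ‖ρ‖ ^ 2 + t) with hθ
    have hθ1 : (1 - θ) = t / (w n * ‖ρ‖ ^ 2 + t) := by
      rw [hθ]; field_simp; ring
    have hθ0 : 0 ≤ θ := by positivity
    have hθ1' : 0 ≤ 1 - θ := by rw [hθ1]; positivity
    refine ⟨(1 - θ) • z₀ + θ • z₁, hC hz₀ hz'C hθ1' hθ0 (by ring), ?_⟩
    have hin : ∀ m, y m - inner ℂ (f m) ((1 - θ) • z₀ + θ • z₁) =
        ((1 - θ : ℝ) : ℂ) * (y m - inner ℂ (f m) z₀) + (θ : ℂ) * (y m - inner ℂ (f m) z₁) := by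
      intro m
      rw [← Complex.coe_smul, ← Complex.coe_smul, inner_add_right, inner_smul_right,
        inner_smul_right]
      push_cast
      ring
    have hsum : ∑ m ∈ J, ((w m : ℂ) * (y m - inner ℂ (f m) ((1 - θ) • z₀ + θ • z₁))) • f m =
        ((θ : ℂ) * c) • f n := by
      have : ∑ m ∈ J, ((w m : ℂ) * (y m - inner ℂ (f m) ((1 - θ) • z₀ + θ • z₁))) • f m =
          ((1 - θ : ℝ) : ℂ) • ∑ m ∈ J, ((w m : ℂ) * (y m - inner ℂ (f m) z₀)) • f m +
          (θ : ℂ) • ∑ m ∈ J, ((w m : ℂ) * (y m - inner ℂ (f m) z₁)) • f m := by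
        rw [Finset.smul_sum, Finset.smul_sum, ← Finset.sum_add_distrib]
        refine Finset.sum_congr rfl fun m _ => ?_
        rw [hin, smul_smul, smul_smul, ← add_smul]
        congr 1
        ring
      rw [this, e₀, e₁, smul_zero, zero_add, smul_smul]
    rw [Finset.sum_insert hn, hsum, hin, hn₁, ← add_smul, ← hρdef, hθ1, hθ]
    have hcρ : c * ((‖ρ‖ : ℂ) ^ 2) = -(t : ℂ) * ρ := by
      rw [← hct, ← Complex.mul_conj']
      ring
    have hden' : ((w n : ℂ) * (‖ρ‖ : ℂ) ^ 2 + t) ≠ 0 := by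
      exact_mod_cast hden.ne'
    convert zero_smul ℂ (f n) using 2
    push_cast
    field_simp
    linear_combination (w n : ℂ) * hcρ

/-- The finite weighted normal equations are solvable with a bound independent of the weights,
provided that all subfamilies have a common lower frame bound on their spans. -/
theorem exists_norm_le_sum_residual_smul_eq_zero {f : ι → H} {K : ℝ} (J : Finset ι)
    (hf : ∀ I ⊆ J, ∀ z ∈ Submodule.span ℂ (f '' I),
      ‖z‖ ≤ K * Real.sqrt (∑ n ∈ I, ‖inner ℂ (f n) z‖ ^ 2)) (hK : 0 ≤ K)
    (w : ι → ℝ) (hw : ∀ n, 0 < w n) (y : ι → ℂ) :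
    ∃ z : H, ‖z‖ ≤ K * Real.sqrt (∑ n ∈ J, ‖y n‖ ^ 2) ∧
      ∑ n ∈ J, ((w n : ℂ) * (y n - inner ℂ (f n) z)) • f n = 0 := by
  obtain ⟨z, hz, e⟩ := exists_mem_convex_sum_residual_smul_eq_zero w hw J f y
    (Metric.closedBall 0 (K * Real.sqrt (∑ n ∈ J, ‖y n‖ ^ 2))) (convex_closedBall _ _) (by
      intro I hI z hz hIz
      rw [mem_closedBall_zero_iff]
      refine (hf I hI z hz).trans ?_
      gcongr
      calc ∑ n ∈ I, ‖inner ℂ (f n) z‖ ^ 2 = ∑ n ∈ I, ‖y n‖ ^ 2 :=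
            Finset.sum_congr rfl fun n hn => by rw [hIz n hn]
        _ ≤ ∑ n ∈ J, ‖y n‖ ^ 2 :=
            Finset.sum_le_sum_of_subset_of_nonneg hI fun _ _ _ => sq_nonneg _)
  exact ⟨z, mem_closedBall_zero_iff.1 hz, e⟩

/-- Weak form of `exists_norm_le_sum_residual_smul_eq_zero`. -/
theorem norm_inner_sum_smul_le {f : ι → H} {K : ℝ} (J : Finset ι)
    (hf : ∀ I ⊆ J, ∀ z ∈ Submodule.span ℂ (f '' I),
      ‖z‖ ≤ K * Real.sqrt (∑ n ∈ I, ‖inner ℂ (f n) z‖ ^ 2)) (hK : 0 ≤ K)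
    (w : ι → ℝ) (hw : ∀ n, 0 < w n) (y : ι → ℂ) (v : H) :
    ‖inner ℂ v (∑ n ∈ J, ((w n : ℂ) * y n) • f n)‖ ≤
      K * Real.sqrt (∑ n ∈ J, ‖y n‖ ^ 2) *
        ‖∑ n ∈ J, ((w n : ℂ) * inner ℂ (f n) v) • f n‖ := by
  obtain ⟨z, hz, e⟩ := exists_norm_le_sum_residual_smul_eq_zero J hf hK w hw y
  have h1 : ∑ n ∈ J, ((w n : ℂ) * y n) • f n =
      ∑ n ∈ J, ((w n : ℂ) * inner ℂ (f n) z) • f n := by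
    rw [← sub_eq_zero, ← Finset.sum_sub_distrib, ← e]
    refine Finset.sum_congr rfl fun n _ => ?_
    rw [← sub_smul, mul_sub]
  -- The weighted frame operator is symmetric, so it can be moved from `z` to `v`.
  have h2 : inner ℂ v (∑ n ∈ J, ((w n : ℂ) * inner ℂ (f n) z) • f n) =
      inner ℂ (∑ n ∈ J, ((w n : ℂ) * inner ℂ (f n) v) • f n) z := by
    rw [inner_sum, sum_inner]
    refine Finset.sum_congr rfl fun n _ => ?_
    rw [inner_smul_right, inner_smul_left, map_mul, Complex.conj_ofReal, inner_conj_symm]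
    ring
  rw [h1, h2]
  refine (norm_inner_le_norm _ _).trans ?_
  rw [mul_comm]
  gcongr

end FiniteLeastSquares

/-! ### Norms in `ℓ²`, analysis and synthesis operators. -/

theorem lp.norm_sq_eq_tsum {ι : Type*} (x : lp (fun _ : ι => ℂ) 2) :
    ‖x‖ ^ 2 = ∑' n, ‖x n‖ ^ 2 := by
  simpa using lp.norm_rpow_eq_tsum (p := 2) (E := fun _ : ι => ℂ) (by norm_num) x

theorem lp.summable_norm_sq {ι : Type*} (x : lp (fun _ : ι => ℂ) 2) :
    Summable fun n => ‖x n‖ ^ 2 := by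
  simpa using (lp.memℓp x).summable (by norm_num)

section Synthesis

variable {ι H : Type*} [NormedAddCommGroup H] [InnerProductSpace ℂ H] {f : ι → H}
  {W : Submodule ℂ H}

theorem IsFrame.exists_bound_analysis (hf : IsFrame f W) :
    ∃ c : NNReal, 0 < c ∧ ∀ x, c * ‖x‖ ^ 2 ≤ ‖hf.analysis x‖ ^ 2 := by
  obtain ⟨A, B, h⟩ := id hf
  refine ⟨⟨A, h.lower_pos.le⟩, h.lower_pos, fun x => ?_⟩
  rw [lp.norm_sq_eq_tsum]
  exact h.lower x x.2

variable [CompleteSpace W]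

theorem IsFrame.synthesis_mem (hf : IsFrame f W) (x : lp (fun _ : ι => ℂ) 2) :
    hf.synthesis x ∈ W :=
  (adjoint hf.analysis x).2

/-- The lower frame bound makes the frame operator on `W` coercive, hence invertible. -/
theorem IsFrame.exists_synthesis_eq (hf : IsFrame f W) {w : H} (hw : w ∈ W) :
    ∃ x, hf.synthesis x = w := by
  obtain ⟨c, hc, h⟩ := hf.exists_bound_analysis
  have hu : IsUnit (adjoint hf.analysis ∘L hf.analysis) := by
    refine isUnit_of_forall_le_norm_inner_map _ hc fun x => ?_
    rw [comp_apply, adjoint_inner_left, inner_self_eq_norm_sq_to_K, mul_comm]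
    simpa using h x
  obtain ⟨u, hu⟩ := (isUnit_iff_bijective.1 hu).2 ⟨w, hw⟩
  exact ⟨hf.analysis u, congrArg Subtype.val hu⟩

theorem IsFrame.isClosed_range_analysis (hf : IsFrame f W) :
    IsClosed (Set.range hf.analysis) := by
  obtain ⟨c, hc, h⟩ := hf.exists_bound_analysis
  have hs : 0 < NNReal.sqrt c := NNReal.sqrt_pos.2 hc
  have : AntilipschitzWith (NNReal.sqrt c)⁻¹ hf.analysis := by
    refine hf.analysis.antilipschitz_of_bound fun x => ?_
    rw [NNReal.coe_inv, inv_mul_eq_div, le_div_iff₀ (by exact_mod_cast hs)]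
    refine le_of_sq_le_sq ?_ (norm_nonneg _)
    rw [mul_pow, ← NNReal.coe_pow, NNReal.sq_sqrt, mul_comm]
    exact h x
  exact this.isClosed_range hf.analysis.uniformContinuous

theorem IsFrame.hasSum_synthesis (hf : IsFrame f W) (x : lp (fun _ : ι => ℂ) 2) :
    HasSum (fun n => x n • f n) (hf.synthesis x) := by
  classical
  have h := hf.synthesis.hasSum (lp.hasSum_single ENNReal.ofNat_ne_top x)
  convert h using 2 with n
  rw [← hf.synthesis_single n, ← map_smul, ← lp.single_smul, smul_eq_mul, mul_one]

variable [CompleteSpace H]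

theorem IsFrame.adjoint_synthesis_apply (hf : IsFrame f W) (x : H) (n : ι) :
    adjoint hf.synthesis x n = inner ℂ (f n) x := by
  classical
  have h := adjoint_inner_right hf.synthesis (lp.single 2 n (1 : ℂ)) x
  rw [lp.inner_single_left, hf.synthesis_single] at h
  simpa using h

theorem IsFrame.adjoint_synthesis_coe (hf : IsFrame f W) (x : W) :
    adjoint hf.synthesis (x : H) = hf.analysis x :=
  lp.ext (funext fun n => hf.adjoint_synthesis_apply x n)

theorem IsFrame.adjoint_synthesis_eq_of_sub_mem (hf : IsFrame f W) {x x' : H}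
    (h : x - x' ∈ Wᗮ) : adjoint hf.synthesis x = adjoint hf.synthesis x' := by
  rw [← sub_eq_zero, ← map_sub]
  refine ext_inner_left ℂ fun y => ?_
  rw [adjoint_inner_right, inner_zero_right]
  exact h _ (hf.synthesis_mem y)

end Synthesis

/-! ### The oblique projection onto `W` along `Mᗮ`. -/

section ObliqueProjection

variable {H : Type*} [NormedAddCommGroup H] [InnerProductSpace ℂ H] [CompleteSpace H]
  {W M : Submodule ℂ H} [CompleteSpace W]

/-- If `H` is the direct sum of the closed subspaces `W` and `Mᗮ`, there is a bounded projection
onto `W` along `Mᗮ`. -/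
theorem exists_oblique_projection (h : IsCompl W Mᗮ) :
    ∃ Q : H →L[ℂ] H, (∀ x, Q x ∈ W) ∧ (∀ x ∈ W, Q x = x) ∧ ∀ x, x - Q x ∈ Mᗮ := by
  have hW : IsClosed (W : Set H) := (completeSpace_coe_iff_isComplete.1 ‹_›).isClosed
  have ht := Submodule.IsCompl.isTopCompl_of_isClosed h hW M.isClosed_orthogonal
  refine ⟨W.projectionL Mᗮ ht, Submodule.projectionL_apply_mem ht,
    fun x hx => Submodule.projectionL_apply_left ht ⟨x, hx⟩, fun x => ?_⟩
  rw [← Submodule.projectionL_apply_eq_zero_iff ht, map_sub,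
    Submodule.projectionL_apply_left ht ⟨_, Submodule.projectionL_apply_mem ht x⟩, sub_self]

/-- The adjoint of the oblique projection `Q` does this: its values are orthogonal to `ker Q ⊇ Mᗮ`,
hence lie in `M`, and `x - Q* x ⊥ W` because `Q` fixes `W`. -/
theorem exists_mem_sub_mem_orthogonal [CompleteSpace M] (h : IsCompl W Mᗮ) (x : H) : ∃ m ∈ M, x - m ∈ Wᗮ := by
  obtain ⟨Q, hQW, hQ, hQM⟩ := exists_oblique_projection h
  refine ⟨adjoint Q x, ?_, fun w hw => ?_⟩
  · rw [← Submodule.orthogonal_orthogonal M]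
    intro u hu
    have hQu : Q u = 0 := by
      have h1 : Q u ∈ Mᗮ := by
        have := sub_mem hu (hQM u)
        rwa [sub_sub_cancel] at this
      exact Submodule.disjoint_def.1 h.disjoint _ (hQW u) h1
    rw [adjoint_inner_right, hQu, inner_zero_left]
  · rw [inner_sub_right, adjoint_inner_right, hQ w hw, sub_self]

/-- An element of `M` is controlled by its inner products with `W`. -/
theorem exists_norm_le_of_norm_inner_le (h : IsCompl W Mᗮ) :
    ∃ C : ℝ, 0 ≤ C ∧ ∀ z ∈ M, ∀ c : ℝ, 0 ≤ c → (∀ w ∈ W, ‖inner ℂ w z‖ ≤ c * ‖w‖) →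
      ‖z‖ ≤ C * c := by
  obtain ⟨Q, hQ, -, hQM⟩ := exists_oblique_projection h
  refine ⟨‖Q‖, norm_nonneg _, fun z hz c hc hzc => ?_⟩
  rcases eq_or_ne z 0 with rfl | hz0
  · simpa using mul_nonneg (norm_nonneg Q) hc
  have h1 : inner ℂ (Q z) z = inner ℂ z z := by
    have := hQM z z hz
    rw [inner_sub_right, sub_eq_zero] at this
    rw [← inner_conj_symm, ← this, inner_conj_symm]
  have h2 : ‖z‖ * ‖z‖ ≤ ‖Q‖ * c * ‖z‖ := by
    calc ‖z‖ * ‖z‖ = ‖inner ℂ (Q z) z‖ := by rw [h1, inner_self_eq_norm_sq_to_K]; simp [sq]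
      _ ≤ c * ‖Q z‖ := hzc _ (hQ z)
      _ ≤ c * (‖Q‖ * ‖z‖) := by gcongr; exact Q.le_opNorm z
      _ = ‖Q‖ * c * ‖z‖ := by ring
  exact le_of_mul_le_mul_right h2 (norm_pos_iff.2 hz0)

end ObliqueProjection

/-! ### Inverse square roots of weights. -/

section Weights

variable {E : Type*} [NormedAddCommGroup E] [InnerProductSpace ℂ E] [CompleteSpace E]
  {D : E →L[ℂ] E}

theorem isSelfAdjoint_invSqrt (D : E →L[ℂ] E) : IsSelfAdjoint (invSqrt D) :=
  (CFC.rpow_nonneg (a := D) (y := -(1 / 2))).isSelfAdjoint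

theorem isUnit_invSqrt (hD : D.IsPositive) (hu : IsUnit D) : IsUnit (invSqrt D) :=
  hu.cfcRpow _ ((nonneg_iff_isPositive D).2 hD)

/-- With this identity only the inverse of the weight has to be known coordinatewise, never its
square root. -/
theorem invSqrt_comp_invSqrt (hD : D.IsPositive) (hu : IsUnit D) {E' : E →L[ℂ] E}
    (hE : E' * D = 1) : invSqrt D ∘L invSqrt D = E' := by
  have h0 : 0 ≤ D := (nonneg_iff_isPositive D).2 hD
  have h : D * (invSqrt D * invSqrt D) = 1 := by
    rw [invSqrt, ← CFC.rpow_add hu]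
    nth_rw 1 [← CFC.rpow_one D h0]
    rw [← CFC.rpow_add hu]
    norm_num
    exact CFC.rpow_zero D h0
  exact (left_inv_eq_right_inv hE h).symm

end Weights

/-! ### The pseudoinverse as a weighted least squares solution. -/

section LeastSquares

variable {ι κ H : Type*} [NormedAddCommGroup H] [InnerProductSpace ℂ H] [CompleteSpace H]
  {W M : Submodule ℂ H} [CompleteSpace W] [CompleteSpace M] {f : ι → H} {g : κ → H}

theorem IsFrame.exists_adjoint_synthesis_comp_eq (hWM : IsCompl W Mᗮ) (hf : IsFrame f W)
    (hg : IsFrame g M) (v : H) :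
    ∃ x, adjoint hf.synthesis (hg.synthesis x) = adjoint hf.synthesis v := by
  obtain ⟨m, hm, hvm⟩ := exists_mem_sub_mem_orthogonal hWM v
  obtain ⟨x, rfl⟩ := hg.exists_synthesis_eq hm
  exact ⟨x, (hf.adjoint_synthesis_eq_of_sub_mem hvm).symm⟩

/-- Since `H = M + Wᗮ`, `T* B` has the range of the analysis operator, which is bounded below; the
invertible `P` is a homeomorphism. -/
theorem IsFrame.isClosed_range_comp (hWM : IsCompl W Mᗮ) (hf : IsFrame f W)
    (hg : IsFrame g M) {P : lp (fun _ : ι => ℂ) 2 →L[ℂ] lp (fun _ : ι => ℂ) 2}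
    (hP : IsUnit P) :
    IsClosed (Set.range (P ∘L adjoint hf.synthesis ∘L hg.synthesis)) := by
  have h1 : Set.range (adjoint hf.synthesis ∘L hg.synthesis) = Set.range hf.analysis := by
    ext y
    constructor
    · rintro ⟨x, rfl⟩
      refine ⟨⟨W.starProjection (hg.synthesis x), W.starProjection_apply_mem _⟩, ?_⟩
      rw [← hf.adjoint_synthesis_coe]
      exact (hf.adjoint_synthesis_eq_of_sub_mem (W.sub_starProjection_mem_orthogonal _)).symm
    · rintro ⟨w, rfl⟩
      obtain ⟨x, hx⟩ := hf.exists_adjoint_synthesis_comp_eq hWM hg w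
      exact ⟨x, hx.trans (hf.adjoint_synthesis_coe w)⟩
  obtain ⟨u, rfl⟩ := hP
  rw [coe_comp, Set.range_comp, h1]
  exact (ContinuousLinearEquiv.unitsEquiv ℂ _ u).toHomeomorph.isClosedMap _
    hf.isClosed_range_analysis

/-- `B (D^{-1/2} T* B)† D^{-1/2} y` solves the weighted least squares problem `T* z ≈ y`. -/
theorem IsFrame.inner_residual_eq_zero (hWM : IsCompl W Mᗮ) (hf : IsFrame f W)
    (hg : IsFrame g M) {D E : lp (fun _ : ι => ℂ) 2 →L[ℂ] lp (fun _ : ι => ℂ) 2}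
    (hD : D.IsPositive) (hu : IsUnit D) (hE : E * D = 1) (y : lp (fun _ : ι => ℂ) 2) (v : H) :
    inner ℂ (E (adjoint hf.synthesis ((hg.synthesis ∘L
      pinv (invSqrt D ∘L adjoint hf.synthesis ∘L hg.synthesis) ∘L invSqrt D) y) - y))
      (adjoint hf.synthesis v) = 0 := by
  set P := invSqrt D with hP
  set A := P ∘L adjoint hf.synthesis ∘L hg.synthesis with hA
  have hX := isMoorePenroseInverse_pinv A (hf.isClosed_range_comp hWM hg (isUnit_invSqrt hD hu))
  set X := pinv A
  obtain ⟨x, hx⟩ := hf.exists_adjoint_synthesis_comp_eq hWM hg v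
  have hPa : ∀ a b, inner ℂ (P a) b = inner ℂ a (P b) := fun a b => by
    rw [← adjoint_inner_right, (isSelfAdjoint_invSqrt D).adjoint_eq]
  have hAX : ∀ a b, inner ℂ (A (X a)) b = inner ℂ a (A (X b)) := fun a b => by
    have := adjoint_inner_right (A ∘L X) a b
    rw [hX.isSelfAdjoint_left.adjoint_eq] at this
    exact this.symm
  have hAXA : A (X (A x)) = A x := congrArg (fun L => L x) hX.comp_comp_left
  -- With `P² = E` the pairing becomes `⟨A X P y - P y, A x⟩`, which vanishes because `A X` is the
  -- orthogonal projection onto the range of `A`.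
  rw [← invSqrt_comp_invSqrt hD hu hE, comp_apply, hPa, ← hx, map_sub, inner_sub_left]
  change inner ℂ (A (X (P y))) (A x) - inner ℂ (P y) (A x) = 0
  rw [hAX, hAXA, sub_self]

end LeastSquares

/-! ### Coordinate projections and diagonal weights. -/

section CoordinateProjection

variable {ι : Type*}

/-- The projection of `ℓ²` onto the coordinates in `I`. -/
noncomputable def coordProj (I : Set ι) :
    lp (fun _ : ι => ℂ) 2 →L[ℂ] lp (fun _ : ι => ℂ) 2 :=
  LinearMap.mkContinuous
    { toFun := fun x => ⟨I.indicator x, memℓp_gen (by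
        refine (lp.summable_norm_sq x).of_nonneg_of_le (fun n => by positivity) fun n => ?_
        have := norm_indicator_le_norm_self (s := I) x n
        simp only [ENNReal.toReal_ofNat, Real.rpow_ofNat]
        gcongr)⟩
      map_add' := fun x y => lp.ext (Set.indicator_add I x y)
      map_smul' := fun c x => lp.ext (Set.indicator_const_smul I c x) } 1 fun x => by
    rw [one_mul]
    refine le_of_sq_le_sq ?_ (norm_nonneg _)
    rw [lp.norm_sq_eq_tsum, lp.norm_sq_eq_tsum]
    refine (lp.summable_norm_sq _).tsum_le_tsum (fun n => ?_) (lp.summable_norm_sq x)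
    have := norm_indicator_le_norm_self (s := I) x n
    gcongr
    exact this

theorem coordProj_apply (I : Set ι) (x : lp (fun _ : ι => ℂ) 2) (n : ι) :
    coordProj I x n = I.indicator x n := rfl

theorem coordProj_coordProj (I : Set ι) (x : lp (fun _ : ι => ℂ) 2) :
    coordProj I (coordProj I x) = coordProj I x :=
  lp.ext ((Set.indicator_indicator I I x).trans (by rw [Set.inter_self]; rfl))

theorem inner_coordProj_left (I : Set ι) (x y : lp (fun _ : ι => ℂ) 2) :
    inner ℂ (coordProj I x) y = inner ℂ x (coordProj I y) := by
  rw [lp.inner_eq_tsum, lp.inner_eq_tsum]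
  refine tsum_congr fun n => ?_
  rw [coordProj_apply, coordProj_apply]
  by_cases hn : n ∈ I <;> simp [hn]

theorem norm_sq_coordProj (I : Set ι) (x : lp (fun _ : ι => ℂ) 2) :
    ‖coordProj I x‖ ^ 2 = ∑' n : I, ‖x n‖ ^ 2 := by
  rw [lp.norm_sq_eq_tsum, tsum_subtype I fun n => ‖x n‖ ^ 2]
  refine tsum_congr fun n => ?_
  rw [coordProj_apply]
  by_cases hn : n ∈ I <;> simp [hn]

theorem norm_coordProj_le (I : Set ι) (x : lp (fun _ : ι => ℂ) 2) : ‖coordProj I x‖ ≤ ‖x‖ :=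
  (le_of_opNorm_le (coordProj I) (LinearMap.mkContinuous_norm_le _ zero_le_one _) x).trans
    (one_mul _).le

theorem norm_apply_le_norm_coordProj {I : Set ι} {n : ι} (hn : n ∈ I)
    (x : lp (fun _ : ι => ℂ) 2) : ‖x n‖ ≤ ‖coordProj I x‖ := by
  have := lp.norm_apply_le_norm (p := 2) (by norm_num) (coordProj I x) n
  rwa [coordProj_apply, Set.indicator_of_mem hn] at this

/-- The diagonal operator with entries `s` at the coordinates in `I` and `t` at the others. -/
noncomputable def twoValued (I : Set ι) (s t : ℝ) :
    lp (fun _ : ι => ℂ) 2 →L[ℂ] lp (fun _ : ι => ℂ) 2 :=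
  (t : ℂ) • 1 + ((s - t : ℝ) : ℂ) • coordProj I

theorem twoValued_apply (I : Set ι) (s t : ℝ) (x : lp (fun _ : ι => ℂ) 2) :
    twoValued I s t x = (t : ℂ) • x + ((s - t : ℝ) : ℂ) • coordProj I x := rfl

open Classical in
theorem twoValued_apply_apply (I : Set ι) (s t : ℝ) (x : lp (fun _ : ι => ℂ) 2) (n : ι) :
    twoValued I s t x n = (if n ∈ I then (s : ℂ) else t) * x n := by
  rw [twoValued_apply, lp.coeFn_add, lp.coeFn_smul, lp.coeFn_smul, Pi.add_apply, Pi.smul_apply,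
    Pi.smul_apply, coordProj_apply]
  by_cases hn : n ∈ I
  · simp only [hn, Set.indicator_of_mem, if_true, smul_eq_mul]
    push_cast
    ring
  · simp [hn]

theorem twoValued_mul_twoValued (I : Set ι) {s t s' t' : ℝ} (hs : s * s' = 1) (ht : t * t' = 1) :
    twoValued I s t * twoValued I s' t' = 1 := by
  ext x n
  rw [mul_apply_eq_comp, twoValued_apply_apply, twoValued_apply_apply, ← mul_assoc,
    one_apply_eq_self]
  split_ifs
  · rw [← Complex.ofReal_mul, hs]; simp
  · rw [← Complex.ofReal_mul, ht]; simp

theorem isPositive_twoValued (I : Set ι) {s t : ℝ} (hs : 0 ≤ s) (ht : 0 ≤ t) :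
    (twoValued I s t).IsPositive := by
  classical
  rw [isPositive_iff_complex]
  intro x
  have : inner ℂ (twoValued I s t x) x =
      ((∑' n, (if n ∈ I then s else t) * ‖x n‖ ^ 2 : ℝ) : ℂ) := by
    rw [lp.inner_eq_tsum, Complex.ofReal_tsum]
    refine tsum_congr fun n => ?_
    rw [twoValued_apply_apply, ← smul_eq_mul, inner_smul_left, inner_self_eq_norm_sq_to_K]
    split_ifs <;> simp
  rw [this]
  refine ⟨by simp, ?_⟩
  rw [RCLike.re_to_complex, Complex.ofReal_re]
  refine tsum_nonneg fun n => ?_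
  split_ifs <;> positivity

theorem twoValued_mem_diagonalWeights (I : Set ι) {s t : ℝ} (hs : 0 < s) (ht : 0 < t) :
    twoValued I s t ∈ diagonalWeights ι := by
  classical
  refine ⟨isPositive_twoValued I hs.le ht.le, ?_, _, twoValued_apply_apply I s t⟩
  exact ⟨⟨_, twoValued I s⁻¹ t⁻¹,
    twoValued_mul_twoValued I (mul_inv_cancel₀ hs.ne') (mul_inv_cancel₀ ht.ne'),
    twoValued_mul_twoValued I (inv_mul_cancel₀ hs.ne') (inv_mul_cancel₀ ht.ne')⟩, rfl⟩

open scoped ComplexOrder in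
/-- The inverse of a diagonal weight is diagonal with positive entries. -/
theorem exists_inverse_of_mem_diagonalWeights
    {D : lp (fun _ : ι => ℂ) 2 →L[ℂ] lp (fun _ : ι => ℂ) 2} (hD : D ∈ diagonalWeights ι) :
    ∃ (E : lp (fun _ : ι => ℂ) 2 →L[ℂ] lp (fun _ : ι => ℂ) 2) (w : ι → ℝ), E * D = 1 ∧
      (∀ n, 0 < w n) ∧ ∀ x n, E x n = w n * x n := by
  classical
  obtain ⟨hpos, ⟨u, rfl⟩, d, hd⟩ := hD
  have hE : ∀ x n, d n * (u⁻¹ : (_ →L[ℂ] _)ˣ).val x n = x n := fun x n => by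
    rw [← hd, ← mul_apply_eq_comp, Units.mul_inv, one_apply_eq_self]
  have hd0 : ∀ n, 0 ≤ d n := fun n => by
    have h := hpos.inner_nonneg_right (lp.single 2 n (1 : ℂ))
    rw [lp.inner_single_left, hd] at h
    simpa using h
  have hdn : ∀ n, d n ≠ 0 := fun n h0 => by
    have := hE (lp.single 2 n (1 : ℂ)) n
    rw [h0, zero_mul] at this
    simp at this
  have hdr : ∀ n, ((d n).re : ℂ) = d n := fun n =>
    (Complex.eq_re_of_ofReal_le (hd0 n)).symm
  refine ⟨(u⁻¹ : (_ →L[ℂ] _)ˣ).val, fun n => (d n).re⁻¹, Units.inv_mul u, fun n => ?_,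
    fun x n => ?_⟩
  · rw [inv_pos]
    refine lt_of_le_of_ne (Complex.le_def.1 (hd0 n)).1 fun h => hdn n ?_
    rw [← hdr, ← h]
    simp
  · rw [← hE x n, Complex.ofReal_inv, hdr, inv_mul_cancel_left₀ (hdn n)]

end CoordinateProjection

/-! ### The two implications. -/

section RieszFrame

variable {ι κ H : Type*} [NormedAddCommGroup H] [InnerProductSpace ℂ H]
  {W M : Submodule ℂ H} {f : ι → H} {g : κ → H}

/-- A Riesz frame has a uniform lower bound for all finite subfamilies on their spans. -/
theorem IsRieszFrame.exists_bound (h : IsRieszFrame f W) :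
    ∃ K : ℝ, 0 ≤ K ∧ ∀ I : Finset ι, ∀ z ∈ Submodule.span ℂ (f '' I),
      ‖z‖ ≤ K * Real.sqrt (∑ n ∈ I, ‖inner ℂ (f n) z‖ ^ 2) := by
  obtain ⟨-, A, B, h⟩ := h
  have hA := (h ∅).lower_pos
  refine ⟨Real.sqrt A⁻¹, Real.sqrt_nonneg _, fun I z hz => ?_⟩
  have h1 := (h I).lower z (Submodule.le_topologicalClosure _ hz)
  have h2 : ∑' n : (I : Set ι), ‖inner ℂ (f n) z‖ ^ 2 = ∑ n ∈ I, ‖inner ℂ (f n) z‖ ^ 2 :=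
    Finset.tsum_subtype' I fun n => ‖inner ℂ (f n) z‖ ^ 2
  rw [h2] at h1
  rw [← Real.sqrt_mul (by positivity)]
  refine Real.le_sqrt_of_sq_le ?_
  rwa [← div_eq_inv_mul, le_div_iff₀ hA, mul_comm]

variable [CompleteSpace H] [CompleteSpace W] [CompleteSpace M]

/-- A uniform lower bound for the restricted analysis operators makes a frame a Riesz frame. -/
theorem IsFrame.isRieszFrame (hf : IsFrame f W) {C : ℝ} (hC : 0 < C)
    (h : ∀ I : Set ι, ∀ x ∈ (Submodule.span ℂ (f '' I)).topologicalClosure,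
      ‖x‖ ≤ C * ‖coordProj I (adjoint hf.synthesis x)‖) : IsRieszFrame f W := by
  -- The `+ 1` keeps the upper bound positive when the synthesis operator vanishes.
  refine ⟨hf, (C ^ 2)⁻¹, ‖adjoint hf.synthesis‖ ^ 2 + 1, fun I => ?_⟩
  have hsum : ∀ x, ∑' n : I, ‖inner ℂ (f n) x‖ ^ 2 =
      ‖coordProj I (adjoint hf.synthesis x)‖ ^ 2 := fun x => by
    simp_rw [norm_sq_coordProj, hf.adjoint_synthesis_apply]
  refine ⟨fun n => Submodule.le_topologicalClosure _ (Submodule.subset_span ⟨n, n.2, rfl⟩),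
    by positivity, by positivity, fun x _ => ?_, fun x hx => ?_, fun x _ => ?_⟩
  · have h2 := lp.summable_norm_sq (adjoint hf.synthesis x)
    simp only [hf.adjoint_synthesis_apply] at h2
    exact h2.subtype I
  · rw [hsum, inv_mul_le_iff₀ (by positivity), ← mul_pow]
    gcongr
    exact h I x hx
  · rw [hsum]
    calc ‖coordProj I (adjoint hf.synthesis x)‖ ^ 2 ≤ (‖adjoint hf.synthesis‖ * ‖x‖) ^ 2 := by
          gcongr
          exact (norm_coordProj_le _ _).trans (le_opNorm _ _)
      _ ≤ _ := by
          rw [mul_pow]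
          gcongr
          linarith

/-- If vectors of norm at most `R` approximate `x` in the closed span of `(f n)_{n ∈ I}` on the
coordinates in `I`, then `‖x‖ ≤ R`. -/
theorem IsFrame.norm_le_of_approx (hf : IsFrame f W) (I : Set ι) {x : H}
    (hx : x ∈ (Submodule.span ℂ (f '' I)).topologicalClosure) {R : ℝ} (hR : 0 ≤ R)
    (h : ∀ η > 0, ∃ z : H, ‖z‖ ≤ R ∧ ‖coordProj I (adjoint hf.synthesis (x - z))‖ ≤ η) :
    ‖x‖ ≤ R := by
  -- Here `c` may depend on `v`: the approximation error is sent to zero for each fixed `v`, so only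
  -- `R` has to be uniform.
  have hspan : ∀ v ∈ Submodule.span ℂ (f '' I), ∃ c : ℝ, 0 ≤ c ∧ ∀ u : H,
      ‖inner ℂ v u‖ ≤ c * ‖coordProj I (adjoint hf.synthesis u)‖ := by
    intro v hv
    induction hv using Submodule.span_induction with
    | mem v hv =>
      obtain ⟨n, hn, rfl⟩ := hv
      refine ⟨1, zero_le_one, fun u => ?_⟩
      rw [one_mul, ← hf.adjoint_synthesis_apply]
      exact norm_apply_le_norm_coordProj hn _
    | zero => exact ⟨0, le_rfl, fun u => by simp⟩
    | add v v' _ _ hv hv' =>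
      obtain ⟨c, hc, hv⟩ := hv
      obtain ⟨c', hc', hv'⟩ := hv'
      refine ⟨c + c', by positivity, fun u => ?_⟩
      rw [inner_add_left, add_mul]
      exact (norm_add_le _ _).trans (add_le_add (hv u) (hv' u))
    | smul a v _ hv =>
      obtain ⟨c, hc, hv⟩ := hv
      refine ⟨‖a‖ * c, by positivity, fun u => ?_⟩
      rw [inner_smul_left, norm_mul, RCLike.norm_conj, mul_assoc]
      gcongr
      exact hv u
  have hbd : ∀ v ∈ Submodule.span ℂ (f '' I), ‖inner ℂ v x‖ ≤ R * ‖v‖ := by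
    intro v hv
    obtain ⟨c, hc, hcv⟩ := hspan v hv
    refine le_of_forall_pos_le_add fun ε hε => ?_
    obtain ⟨z, hz, hxz⟩ := h (ε / (c + 1)) (by positivity)
    calc ‖inner ℂ v x‖ = ‖inner ℂ v z + inner ℂ v (x - z)‖ := by
          rw [← inner_add_right, add_sub_cancel]
      _ ≤ ‖v‖ * ‖z‖ + c * ‖coordProj I (adjoint hf.synthesis (x - z))‖ :=
          (norm_add_le _ _).trans (add_le_add (norm_inner_le_norm _ _) (hcv _))
      _ ≤ ‖v‖ * R + (c + 1) * (ε / (c + 1)) := by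
          gcongr
          linarith
      _ = R * ‖v‖ + ε := by
          field_simp
  have hcl : ∀ v ∈ (Submodule.span ℂ (f '' I)).topologicalClosure,
      ‖inner ℂ v x‖ ≤ R * ‖v‖ := by
    intro v hv
    have hc : IsClosed {v : H | ‖inner ℂ v x‖ ≤ R * ‖v‖} :=
      isClosed_le (by fun_prop) (by fun_prop)
    exact closure_minimal (s := (Submodule.span ℂ (f '' I) : Set H)) hbd hc hv
  have h1 := hcl x hx
  rcases eq_or_ne x 0 with rfl | hx0
  · simpa using hR
  rw [inner_self_eq_norm_sq_to_K, norm_pow, RCLike.norm_ofReal, abs_norm, sq] at h1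
  exact le_of_mul_le_mul_right h1 (norm_pos_iff.2 hx0)

/-- A penalty argument: making the weight off `I` tend to zero forces the residual on `I` to zero,
while the hypothesis keeps the solutions bounded. -/
theorem IsFrame.isRieszFrame_of_bddAbove (hWM : IsCompl W Mᗮ) (hf : IsFrame f W)
    (hg : IsFrame g M)
    (h : BddAbove ((fun D : lp (fun _ : ι => ℂ) 2 →L[ℂ] lp (fun _ : ι => ℂ) 2 =>
        ‖hg.synthesis ∘L pinv (invSqrt D ∘L adjoint hf.synthesis ∘L hg.synthesis) ∘L
          invSqrt D‖) '' diagonalWeights ι)) : IsRieszFrame f W := by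
  obtain ⟨C₀, hC₀⟩ := h
  set C := max C₀ 1
  have hC : 0 < C := zero_lt_one.trans_le (le_max_right _ _)
  refine hf.isRieszFrame hC fun I x hx => ?_
  set S := adjoint hf.synthesis with hS
  refine hf.norm_le_of_approx I hx (by positivity) fun η hη => ?_
  set y := coordProj I (S x) with hy
  -- A bound for `‖S z‖ * ‖S (z - x)‖` that does not involve `ε`, so that `ε` can be chosen
  -- afterwards with `ε * k ≤ η ^ 2`.
  set k := ‖S‖ * (C * ‖y‖) * (‖S‖ * (C * ‖y‖) + ‖S x‖) with hk
  have hk0 : 0 ≤ k := by positivity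
  set ε := η ^ 2 / (k + 1) with hε
  have hε0 : 0 < ε := by positivity
  have hD := twoValued_mem_diagonalWeights I one_pos (inv_pos.2 hε0)
  set z := (hg.synthesis ∘L pinv (invSqrt (twoValued I 1 ε⁻¹) ∘L adjoint hf.synthesis ∘L
    hg.synthesis) ∘L invSqrt (twoValued I 1 ε⁻¹)) y with hz
  have hzn : ‖z‖ ≤ C * ‖y‖ :=
    le_of_opNorm_le _ ((hC₀ ⟨_, hD, rfl⟩).trans (le_max_left _ _)) y
  refine ⟨z, hzn, ?_⟩
  have key := hf.inner_residual_eq_zero hWM hg hD.1 hD.2.1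
    (twoValued_mul_twoValued I (one_mul 1) (mul_inv_cancel₀ hε0.ne')) y (z - x)
  rw [← hz, ← hS] at key
  set δ := S (z - x) with hδ
  -- On `I` the data `y` agree with `S x`; off `I` they are zero, which leaves `ε` times the part of
  -- `S z` off `I`.
  have h1 : twoValued I 1 ε (S z - y) =
      coordProj I δ + (ε : ℂ) • (S z - coordProj I (S z)) := by
    rw [twoValued_apply, hδ, map_sub S, map_sub, map_sub, hy, coordProj_coordProj]
    push_cast
    module
  have h2 : ((‖coordProj I δ‖ ^ 2 : ℝ) : ℂ) =
      -((ε : ℂ) * inner ℂ (S z) (δ - coordProj I δ)) := by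
    have h3 : inner ℂ (coordProj I δ) δ = ((‖coordProj I δ‖ ^ 2 : ℝ) : ℂ) := by
      rw [← coordProj_coordProj, inner_coordProj_left, inner_self_eq_norm_sq_to_K]
      simp [coordProj_coordProj]
    rw [h1, inner_add_left, h3, inner_smul_left, inner_sub_left, inner_coordProj_left,
      ← inner_sub_right, Complex.conj_ofReal] at key
    exact eq_neg_of_add_eq_zero_left key
  have h4 : ‖δ - coordProj I δ‖ ≤ ‖δ‖ := by
    have h5 : inner ℂ (coordProj I δ) (δ - coordProj I δ) = 0 := by
      rw [inner_sub_right, inner_coordProj_left, inner_coordProj_left, coordProj_coordProj,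
        sub_self]
    have h6 := norm_add_sq_eq_norm_sq_add_norm_sq_of_inner_eq_zero _ _ h5
    rw [add_sub_cancel] at h6
    refine le_of_sq_le_sq ?_ (norm_nonneg _)
    nlinarith [norm_nonneg (coordProj I δ)]
  have hSz : ‖S z‖ ≤ ‖S‖ * (C * ‖y‖) := (S.le_opNorm z).trans (by gcongr)
  have h7 : ‖coordProj I δ‖ ^ 2 ≤ η ^ 2 := by
    have h8 := congrArg norm h2
    rw [Complex.norm_real, Real.norm_of_nonneg (by positivity), norm_neg, norm_mul,
      Complex.norm_real, Real.norm_of_nonneg hε0.le] at h8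
    calc ‖coordProj I δ‖ ^ 2 ≤ ε * (‖S z‖ * ‖δ‖) := by
          rw [h8]
          gcongr
          exact (norm_inner_le_norm _ _).trans (by gcongr)
      _ ≤ ε * k := by
          rw [hk]
          gcongr
          rw [hδ, map_sub]
          exact (norm_sub_le _ _).trans (by gcongr)
      _ ≤ ε * (k + 1) := by gcongr; linarith
      _ = η ^ 2 := by rw [hε]; field_simp
  have h9 : ‖coordProj I (S (x - z))‖ = ‖coordProj I δ‖ := by
    rw [hδ, ← neg_sub z x, map_neg, map_neg, norm_neg]
  rw [h9]
  exact le_of_sq_le_sq h7 hη.le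

/-- For a Riesz frame, `T D⁻¹ y` is bounded by `T D⁻¹ T*`, uniformly in the weight. -/
theorem IsRieszFrame.exists_norm_inner_synthesis_le (h : IsRieszFrame f W) (hf : IsFrame f W) :
    ∃ K : ℝ, 0 ≤ K ∧ ∀ (E : lp (fun _ : ι => ℂ) 2 →L[ℂ] lp (fun _ : ι => ℂ) 2) (w : ι → ℝ),
      (∀ n, 0 < w n) → (∀ x n, E x n = w n * x n) → ∀ y v,
      ‖inner ℂ v (hf.synthesis (E y))‖ ≤
        K * ‖y‖ * ‖hf.synthesis (E (adjoint hf.synthesis v))‖ := by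
  obtain ⟨K, hK, hb⟩ := h.exists_bound
  refine ⟨K, hK, fun E w hw hE y v => ?_⟩
  have h1 := hf.hasSum_synthesis (E y)
  have h2 := hf.hasSum_synthesis (E (adjoint hf.synthesis v))
  simp_rw [hE] at h1 h2
  simp_rw [hf.adjoint_synthesis_apply] at h2
  -- For fixed `v` both sides converge as `J` exhausts the index set, so the finite solutions
  -- themselves need not converge.
  refine le_of_tendsto_of_tendsto' ((tendsto_const_nhds.inner h1).norm)
    (h2.norm.const_mul (K * ‖y‖)) fun J => ?_
  refine (norm_inner_sum_smul_le J (fun I _ => hb I) hK w hw y v).trans ?_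
  gcongr
  refine Real.sqrt_le_left (norm_nonneg _) |>.2 ?_
  rw [lp.norm_sq_eq_tsum]
  exact (lp.summable_norm_sq y).sum_le_tsum J fun n _ => sq_nonneg _

/-- The operators `T E T*`, with `E` a positive diagonal operator, have dense range in `W`. -/
theorem IsFrame.mem_closure_range_synthesis_comp (hf : IsFrame f W)
    {E : lp (fun _ : ι => ℂ) 2 →L[ℂ] lp (fun _ : ι => ℂ) 2} {w : ι → ℝ} (hw : ∀ n, 0 < w n)
    (hE : ∀ x n, E x n = w n * x n) {u : H} (hu : u ∈ W) :
    u ∈ (hf.synthesis ∘L E ∘L adjoint hf.synthesis).range.topologicalClosure := by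
  set R := (hf.synthesis ∘L E ∘L adjoint hf.synthesis).range with hR
  have hRW : R.topologicalClosure ≤ W := by
    refine Submodule.topologicalClosure_minimal _ ?_
      (completeSpace_coe_iff_isComplete.1 ‹_›).isClosed
    rintro _ ⟨v, rfl⟩
    exact hf.synthesis_mem _
  have : CompleteSpace R.topologicalClosure :=
    R.isClosed_topologicalClosure.completeSpace_coe
  set p := R.topologicalClosure.starProjection u
  have hp : p ∈ R.topologicalClosure := Submodule.starProjection_apply_mem _ _
  have hx : u - p ∈ R.topologicalClosureᗮ := Submodule.sub_starProjection_mem_orthogonal u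
  set x := u - p with hxdef
  have hxW : x ∈ W := sub_mem hu (hRW hp)
  -- Testing `x` against its own image gives `∑ w n * ‖⟨f n, x⟩‖ ^ 2 = 0`, and the lower frame bound
  -- then yields `x = 0`.
  have h0 : inner ℂ (hf.synthesis (E (adjoint hf.synthesis x))) x = 0 :=
    hx _ (R.le_topologicalClosure ⟨x, rfl⟩)
  rw [← adjoint_inner_right] at h0
  have h1 : HasSum (fun n => w n * ‖inner ℂ (f n) x‖ ^ 2) 0 := by
    have := lp.hasSum_inner (𝕜 := ℂ) (E (adjoint hf.synthesis x)) (adjoint hf.synthesis x)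
    rw [h0] at this
    rw [← Complex.hasSum_ofReal]
    convert! this using 2 with n
    rw [hE, ← smul_eq_mul (w n : ℂ), inner_smul_left, inner_self_eq_norm_sq_to_K,
      hf.adjoint_synthesis_apply]
    simp
  have h2 := (hasSum_zero_iff_of_nonneg fun n => by have := hw n; positivity).1 h1
  have h3 : ∀ n, inner ℂ (f n) x = 0 := fun n => by
    have := congrFun h2 n
    simpa [(hw n).ne'] using this
  have h4 : x = 0 := by
    obtain ⟨A, B, h⟩ := hf
    have := h.lower x hxW
    simp only [h3, norm_zero, ne_eq, OfNat.ofNat_ne_zero, not_false_eq_true, zero_pow,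
      tsum_zero] at this
    have h5 : ‖x‖ ^ 2 ≤ 0 := nonpos_of_mul_nonpos_right this h.lower_pos
    simpa using le_antisymm h5 (sq_nonneg _)
  rwa [← sub_eq_zero.1 h4] at hp

/-- By the normal equations and symmetry, `⟨T E T* v, z⟩ = ⟨v, T E y⟩`. The Riesz frame estimate
bounds this, and density of the range of `T E T*` in `W` extends the bound to all of `W`. -/
theorem IsRieszFrame.bddAbove (hWM : IsCompl W Mᗮ) (h : IsRieszFrame f W) (hf : IsFrame f W)
    (hg : IsFrame g M) :
    BddAbove ((fun D : lp (fun _ : ι => ℂ) 2 →L[ℂ] lp (fun _ : ι => ℂ) 2 =>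
        ‖hg.synthesis ∘L pinv (invSqrt D ∘L adjoint hf.synthesis ∘L hg.synthesis) ∘L
          invSqrt D‖) '' diagonalWeights ι) := by
  obtain ⟨K, hK, hb⟩ := h.exists_norm_inner_synthesis_le hf
  obtain ⟨C, hC, hCM⟩ := exists_norm_le_of_norm_inner_le hWM
  refine ⟨C * K, ?_⟩
  rintro _ ⟨D, hD, rfl⟩
  refine opNorm_le_bound _ (by positivity) fun y => ?_
  obtain ⟨E, w, hED, hw, hE⟩ := exists_inverse_of_mem_diagonalWeights hD
  have key := hf.inner_residual_eq_zero hWM hg hD.1 hD.2.1 hED y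
  set z := (hg.synthesis ∘L pinv (invSqrt D ∘L adjoint hf.synthesis ∘L hg.synthesis) ∘L
    invSqrt D) y
  rw [mul_assoc]
  refine hCM z (hg.synthesis_mem _) (K * ‖y‖) (by positivity) fun u hu => ?_
  have hnormal : hf.synthesis (E (adjoint hf.synthesis z)) = hf.synthesis (E y) := by
    refine ext_inner_right ℂ fun v => ?_
    have := key v
    rwa [map_sub, inner_sub_left, sub_eq_zero, adjoint_inner_right, adjoint_inner_right] at this
  have hEs : ∀ a b, inner ℂ (E a) b = inner ℂ a (E b) := fun a b => by
    rw [lp.inner_eq_tsum, lp.inner_eq_tsum]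
    refine tsum_congr fun n => ?_
    rw [hE, hE, ← smul_eq_mul, ← smul_eq_mul, inner_smul_left, inner_smul_right,
      Complex.conj_ofReal]
  have hrange : ∀ v, ‖inner ℂ (hf.synthesis (E (adjoint hf.synthesis v))) z‖ ≤
      K * ‖y‖ * ‖hf.synthesis (E (adjoint hf.synthesis v))‖ := fun v => by
    have : inner ℂ (hf.synthesis (E (adjoint hf.synthesis v))) z =
        inner ℂ v (hf.synthesis (E y)) := by
      rw [← hnormal, ← adjoint_inner_right, hEs, adjoint_inner_left]
    rw [this]
    exact hb E w hw hE y v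
  have hc : IsClosed {u : H | ‖inner ℂ u z‖ ≤ K * ‖y‖ * ‖u‖} :=
    isClosed_le (by fun_prop) (by fun_prop)
  refine closure_minimal ?_ hc (hf.mem_closure_range_synthesis_comp hw hE hu)
  rintro _ ⟨v, rfl⟩
  exact hrange v

end RieszFrame

theorem mainTheorem2 {ι κ H : Type*} [Countable ι] [Countable κ]
    [NormedAddCommGroup H] [InnerProductSpace ℂ H] [CompleteSpace H]
    [TopologicalSpace.SeparableSpace H]
    (W M : Submodule ℂ H) [CompleteSpace W] [CompleteSpace M] (hWM : IsCompl W Mᗮ)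
    (f : ι → H) (hf : IsFrame f W) (g : κ → H) (hg : IsFrame g M) :
    (∀ D ∈ diagonalWeights ι, IsClosed
      (Set.range (invSqrt D ∘L adjoint hf.synthesis ∘L hg.synthesis))) ∧
    (IsRieszFrame f W ↔
      BddAbove ((fun D : lp (fun _ : ι => ℂ) 2 →L[ℂ] lp (fun _ : ι => ℂ) 2 =>
        ‖hg.synthesis ∘L pinv (invSqrt D ∘L adjoint hf.synthesis ∘L hg.synthesis) ∘L
          invSqrt D‖) '' diagonalWeights ι)) :=
  ⟨fun _ hD => hf.isClosed_range_comp hWM hg (isUnit_invSqrt hD.1 hD.2.1),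
    fun h => h.bddAbove hWM hf hg, hf.isRieszFrame_of_bddAbove hWM hg⟩
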